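/- Let $p$ be a prime, let $1<k<p$, and let $A\subset\mathbb{F}_p$ with $|A|=m$. Let $X_{A,k}$ be the abstract simplicial complex on the vertex set $\mathbb{F}_p$ whose faces are all nonempty subsets of $\mathbb{F}_p$ with fewer than $k$ elements, together with all $k$-element subsets $\sigma\subset\mathbb{F}_p$ such that $\sum_{x\in\sigma}x\in A$. Then the simplicial homology of $X_{A,k}$ with coefficients in $\mathbb{F}_p$ satisfies $$\dim_{\mathbb{F}_p} H_{k-1}(X_{A,k};\mathbb{F}_p)=\begin{cases}0 & \text{if } m\le k,\\ \left(\dfrac{m}{k}-1\right)\dbinom{p-1}{k-1} & \text{if } m>k.\end{cases}$$ -/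

import Mathlib

/-- The submodule underlying the space `C_n(X; R)` of simplicial `n`-chains with coefficients in `R` of an abstract simplicial
complex `X` on a finite vertex set `V`. A chain `∑ c_σ [v₀, …, vₙ]` is recorded by its
coefficients on oriented simplices: `φ (v₀, …, vₙ)` is the coefficient of `[v₀, …, vₙ]`.
So the chains are the skew-symmetric functions on `V ^ (n + 1)` (vanishing when two vertices
coincide) that are supported on the `n`-simplices of `X`. -/
def simplicialChains (R : Type*) [CommRing R] {V : Type*} [DecidableEq V]
    (X : PreAbstractSimplicialComplex V) (n : ℕ) : Submodule R ((Fin (n + 1) → V) → R) where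
  carrier := {φ |
    (∀ (σ : Equiv.Perm (Fin (n + 1))) (v : Fin (n + 1) → V),
      φ (v ∘ σ) = ((Equiv.Perm.sign σ : ℤ) : R) * φ v) ∧
    (∀ v : Fin (n + 1) → V, ¬ Function.Injective v → φ v = 0) ∧
    (∀ v : Fin (n + 1) → V, φ v ≠ 0 → Finset.univ.image v ∈ X.faces)}
  zero_mem' := by simp
  add_mem' := by
    rintro φ ψ ⟨h1, h2, h3⟩ ⟨k1, k2, k3⟩
    refine ⟨fun σ v => ?_, fun v hv => ?_, fun v hv => ?_⟩
    · simp only [Pi.add_apply, h1, k1, mul_add]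
    · simp [h2 v hv, k2 v hv]
    · by_cases h : φ v = 0
      · exact k3 v (by simpa [h] using hv)
      · exact h3 v h
  smul_mem' := by
    rintro c φ ⟨h1, h2, h3⟩
    refine ⟨fun σ v => ?_, fun v hv => ?_, fun v hv => ?_⟩
    · simp only [Pi.smul_apply, h1, smul_eq_mul]; ring
    · simp [h2 v hv]
    · exact h3 v (fun h => hv (by simp [h]))

/-- The `R`-module `C_n(X; R)` of simplicial `n`-chains of `X`. -/
def SimplicialChain (R : Type*) [CommRing R] {V : Type*} [DecidableEq V]
    (X : PreAbstractSimplicialComplex V) (n : ℕ) : Type _ :=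
  simplicialChains R X n

instance SimplicialChain.instAddCommGroup (R : Type*) [CommRing R] {V : Type*} [DecidableEq V]
    (X : PreAbstractSimplicialComplex V) (n : ℕ) : AddCommGroup (SimplicialChain R X n) :=
  inferInstanceAs (AddCommGroup (simplicialChains R X n))

instance SimplicialChain.instModule (R : Type*) [CommRing R] {V : Type*} [DecidableEq V]
    (X : PreAbstractSimplicialComplex V) (n : ℕ) : Module R (SimplicialChain R X n) :=
  inferInstanceAs (Module R (simplicialChains R X n))

/-- The simplicial boundary map `∂ : C_{n+1}(X; R) → C_n(X; R)`, the linear extension of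
`[v₀, …, v_{n+1}] ↦ ∑ i, (-1) ^ i [v₀, …, v̂ᵢ, …, v_{n+1}]`. In terms of coefficients,
the coefficient of `∂ φ` at `[v₀, …, vₙ]` is the sum over all `x` of the coefficient of `φ` at
`[x, v₀, …, vₙ]`. -/
def simplicialBoundary (R : Type*) [CommRing R] {V : Type*} [DecidableEq V] [Fintype V]
    (X : PreAbstractSimplicialComplex V) (n : ℕ) :
    SimplicialChain R X (n + 1) →ₗ[R] SimplicialChain R X n where
  toFun φ := ⟨fun v => ∑ x : V, φ.1 (Fin.cons x v), by
    obtain ⟨φ, h1, h2, h3⟩ := φ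
    refine ⟨fun σ v => ?_, fun v hv => ?_, fun v hv => ?_⟩
    · rw [Finset.mul_sum]
      refine Finset.sum_congr rfl fun x _ => ?_
      have e : (Fin.cons x (v ∘ σ) : Fin (n + 1 + 1) → V)
          = (Fin.cons x v : Fin (n + 1 + 1) → V) ∘ Equiv.Perm.decomposeFin.symm (0, σ) := by
        funext i
        refine Fin.cases ?_ (fun j => ?_) i <;> simp
      have h := h1 (Equiv.Perm.decomposeFin.symm (0, σ)) (Fin.cons x v)
      rw [← e] at h
      refine h.trans ?_
      simp
    · refine Finset.sum_eq_zero fun x _ => h2 _ fun hx => hv ?_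
      exact (Fin.cons_injective_iff.1 hx).2
    · obtain ⟨x, -, hx⟩ := Finset.exists_ne_zero_of_sum_ne_zero hv
      refine (X.isRelLowerSet_faces (h3 _ hx)).2 ?_ (by simp)
      intro y hy
      obtain ⟨i, -, rfl⟩ := Finset.mem_image.1 hy
      exact Finset.mem_image.2 ⟨i.succ, by simp, by simp⟩⟩
  map_add' φ ψ := by
    refine Subtype.ext (funext fun v => ?_)
    exact Finset.sum_add_distrib
  map_smul' c φ := by
    refine Subtype.ext (funext fun v => ?_)
    exact (Finset.mul_sum _ _ _).symm

theorem simplicialBoundary_comp_simplicialBoundary (R : Type*) [CommRing R] {V : Type*}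
    [DecidableEq V] [Fintype V] (X : PreAbstractSimplicialComplex V) (n : ℕ) :
    simplicialBoundary R X n ∘ₗ simplicialBoundary R X (n + 1) = 0 := by
  refine LinearMap.ext fun ⟨φ, h1, h2, h3⟩ => Subtype.ext (funext fun v => ?_)
  change ∑ x : V, ∑ y : V, φ (Fin.cons y (Fin.cons x v)) = 0
  rw [← Finset.sum_product']
  refine Finset.sum_involution (fun a _ => (a.2, a.1)) ?_ ?_ (by simp) (by simp)
  · rintro ⟨x, y⟩ -
    have e : (Fin.cons x (Fin.cons y v : Fin (n + 1 + 1) → V) : Fin (n + 1 + 1 + 1) → V)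
        = (Fin.cons y (Fin.cons x v : Fin (n + 1 + 1) → V) : Fin (n + 1 + 1 + 1) → V)
          ∘ Equiv.swap 0 1 := by
      funext i
      refine Fin.cases ?_ (fun j => Fin.cases ?_ (fun l => ?_) j) i
      · rw [Function.comp_apply, Equiv.swap_apply_left]
        rfl
      · simp
      · have h0 : (l.succ.succ : Fin (n + 1 + 1 + 1)) ≠ 0 := Fin.succ_ne_zero _
        have h1 : (l.succ.succ : Fin (n + 1 + 1 + 1)) ≠ 1 := by
          rw [← Fin.succ_zero_eq_one]
          exact fun h => Fin.succ_ne_zero _ (Fin.succ_injective _ h)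
        simp [Equiv.swap_apply_of_ne_of_ne h0 h1]
    simp only [e, h1]
    rw [Equiv.Perm.sign_swap (by simp)]
    simp
  · rintro ⟨x, y⟩ - hne heq
    obtain rfl : x = y := (Prod.ext_iff.1 heq).2
    refine hne (h2 _ fun hinj => ?_)
    have := @hinj 0 1 rfl
    simp at this

/-- The space `Z_n(X; R)` of simplicial `n`-cycles; every `0`-chain is a cycle. -/
def simplicialCycles (R : Type*) [CommRing R] {V : Type*} [DecidableEq V] [Fintype V]
    (X : PreAbstractSimplicialComplex V) : (n : ℕ) → Submodule R (SimplicialChain R X n)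
  | 0 => ⊤
  | n + 1 => LinearMap.ker (simplicialBoundary R X n)

/-- The space `B_n(X; R)` of simplicial `n`-boundaries. -/
def simplicialBoundaries (R : Type*) [CommRing R] {V : Type*} [DecidableEq V] [Fintype V]
    (X : PreAbstractSimplicialComplex V) (n : ℕ) : Submodule R (SimplicialChain R X n) :=
  LinearMap.range (simplicialBoundary R X n)

theorem simplicialBoundaries_le_simplicialCycles (R : Type*) [CommRing R] {V : Type*}
    [DecidableEq V] [Fintype V] (X : PreAbstractSimplicialComplex V) (n : ℕ) :
    simplicialBoundaries R X n ≤ simplicialCycles R X n := by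
  cases n with
  | zero => exact le_top
  | succ n =>
    exact LinearMap.range_le_ker_iff.2 (simplicialBoundary_comp_simplicialBoundary R X n)

/-- The `n`-th simplicial homology `H_n(X; R) = Z_n(X; R) / B_n(X; R)`. -/
abbrev SimplicialHomology (R : Type*) [CommRing R] {V : Type*} [DecidableEq V] [Fintype V]
    (X : PreAbstractSimplicialComplex V) (n : ℕ) : Type _ :=
  simplicialCycles R X n ⧸ (simplicialBoundaries R X n).submoduleOf (simplicialCycles R X n)

/-- The sum complex `X_{A,k}` on the vertex set `𝔽_p`: its faces are all nonempty sets of fewer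
than `k` vertices (the full `(k - 2)`-skeleton of the simplex on `𝔽_p`), together with the
`k`-element sets whose sum lies in `A`. -/
def sumComplex {p : ℕ} (A : Finset (ZMod p)) (k : ℕ) :
    PreAbstractSimplicialComplex (ZMod p) where
  faces := {σ | σ.Nonempty ∧ (σ.card < k ∨ (σ.card = k ∧ ∑ x ∈ σ, x ∈ A))}
  isRelLowerSet_faces := by
    rintro σ ⟨hne, h⟩
    refine ⟨hne, fun τ hτ hτne => ⟨hτne, ?_⟩⟩
    rcases eq_or_ne τ σ with rfl | hneq
    · exact h
    · have := Finset.card_lt_card (Finset.ssubset_iff_subset_ne.2 ⟨hτ, hneq⟩)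
      left
      omega

/-!
Let `K = 𝔽_p`. There are no chains above dimension `k - 1`, so `H_{k-1}` is the kernel of the
boundary map on the `(k - 1)`-chains. These have dimension `m / k * choose (p - 1) (k - 1)`:
translation of subsets shows that every sum is taken by equally many `k`-element sets. The image
of the boundary map consists of cycles of the full skeleton, and these are determined by their
coefficients at the `choose (p - 1) (k - 1)` simplices avoiding the vertex `0`
(`ker_chainCoeffs_comp_simplicialBoundary`). Hence everything follows once the boundary map is
known to be injective for `m ≤ k`: for `m = k` it is then onto this space of cycles by
dimension, hence also for `m > k`, and rank-nullity gives the formula.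

Injectivity (`eq_zero_of_skew_of_sum_cons_eq_zero`) is a multivariate form of the fact that
a nonzero polynomial of degree less than `p` over `𝔽_p` with at most `k` terms cannot vanish to
order `k` at `1`. For `a ∈ A` let `G a` be the part of the chain on tuples with sum `a`, translated
along `(1, …, 1)` so that it is invariant under this direction, and regarded as an element of the
group algebra `R` of `K ^ k`. Being a cycle means that the polynomial `F(t) = ∑ a ∈ A, G a * t ^ a`
over `R` vanishes at the `k` group elements `T i` corresponding to the `-e_i`. The coefficients
are skew under permutations of the coordinates, and `T i - T j` acts injectively on elements that
are skew under the swap of `i` and `j`. Thus the divided differences of `F` at the points `T i`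
vanish as well (`weightedCoeff_prod_shiftedGeom_eq_zero`). Modulo the augmentation ideal, where all
`T i` become `1`, the divided difference of order `r` is `∑ a, choose a r * G a`. As `|A| ≤ k` and
the elements of `A` are distinct modulo `p`, these sums for `r < k` determine the `G a`. So the
ideal generated by the `G a` is its own product with the augmentation ideal, which consists of
nilpotent elements, and Nakayama's lemma gives `G a = 0`
(`eq_zero_of_weightedCoeff_eq_zero`).
-/

/-! ### Divided differences of polynomials with skew coefficients -/

section DividedDifferences

variable {R : Type*} [CommRing R]

/-- The power series `X / (1 - t X) = ∑ a, t ^ a X ^ (a + 1)`. -/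
noncomputable def shiftedGeom (t : R) : PowerSeries R :=
  PowerSeries.X * PowerSeries.mk fun a => t ^ a

theorem coeff_succ_shiftedGeom (t : R) (a : ℕ) :
    PowerSeries.coeff (a + 1) (shiftedGeom t) = t ^ a := by
  rw [shiftedGeom, PowerSeries.coeff_succ_X_mul, PowerSeries.coeff_mk]

theorem map_shiftedGeom {S : Type*} [CommRing S] (σ : R →+* S) (t : R) :
    PowerSeries.map σ (shiftedGeom t) = shiftedGeom (σ t) := by
  ext a
  simp only [shiftedGeom, map_mul, PowerSeries.map_X]
  cases a with
  | zero => simp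
  | succ a => simp [PowerSeries.coeff_succ_X_mul]

theorem C_sub_mul_shiftedGeom_mul_shiftedGeom (t u : R) :
    PowerSeries.C (t - u) * (shiftedGeom t * shiftedGeom u) = shiftedGeom t - shiftedGeom u := by
  have key : ∀ s : R,
      (PowerSeries.mk fun a => s ^ a) * (1 - PowerSeries.C s * PowerSeries.X) = 1 := by
    intro s
    ext a
    cases a with
    | zero => simp
    | succ a =>
      rw [mul_sub, mul_one, mul_left_comm, ← mul_assoc, map_sub, PowerSeries.coeff_succ_mul_X]
      simp [PowerSeries.coeff_one, pow_succ']
  have ht := key t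
  have hu := key u
  simp only [shiftedGeom, map_sub]
  set a := PowerSeries.mk fun a => t ^ a
  set b := PowerSeries.mk fun a => u ^ a
  linear_combination PowerSeries.X * a * hu - PowerSeries.X * b * ht

/-- Extraction of the coefficients of a power series at the exponents `e a + 1`, paired with the
weights `G a`. On `shiftedGeom t` it evaluates the "polynomial" `∑ a, G a * t ^ e a`, and on
`∏ i ∈ s, shiftedGeom (T i)` it gives the divided difference of that polynomial at the
points `T i`, with no division involved. -/
noncomputable def weightedCoeff {α : Type*} (A : Finset α) (e : α → ℕ) (G : α → R) :
    PowerSeries R →ₗ[R] R :=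
  ∑ a ∈ A, G a • PowerSeries.coeff (e a + 1)

variable {α : Type*} (A : Finset α) (e : α → ℕ) (G : α → R)

theorem weightedCoeff_apply (f : PowerSeries R) :
    weightedCoeff A e G f = ∑ a ∈ A, G a * PowerSeries.coeff (e a + 1) f := by
  simp [weightedCoeff]

theorem weightedCoeff_C_mul (r : R) (f : PowerSeries R) :
    weightedCoeff A e G (PowerSeries.C r * f) = r * weightedCoeff A e G f := by
  rw [← PowerSeries.smul_eq_C_mul, map_smul, smul_eq_mul]

theorem map_weightedCoeff_of_skew (σ : R →+* R) (hG : ∀ a, σ (G a) = -G a) (f : PowerSeries R) :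
    σ (weightedCoeff A e G f) = -weightedCoeff A e G (PowerSeries.map σ f) := by
  simp [weightedCoeff_apply, hG]

/-- If a polynomial with skew coefficients vanishes at all the points `T i`, then so do its
divided differences at any of these points. The difference `T i - T j` times the divided
difference is zero by induction; since the divided difference is symmetric in the points, it is
reversed in sign by the swap of `i` and `j`, and on such elements `T i - T j` acts injectively. -/
theorem weightedCoeff_prod_shiftedGeom_eq_zero {ι : Type*} [DecidableEq ι] (T : ι → R)
    (σ : ι → ι → R →+* R) (hT : ∀ i j l, σ i j (T l) = T (Equiv.swap i j l))
    (hG : ∀ i j, i ≠ j → ∀ a, σ i j (G a) = -G a)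
    (hreg : ∀ i j, i ≠ j → ∀ z, T i * z = T j * z → σ i j z = -z → z = 0)
    (hzero : ∀ i, ∑ a ∈ A, G a * T i ^ e a = 0) :
    ∀ (n : ℕ) (s : Finset ι), s.card = n + 1 →
      weightedCoeff A e G (∏ i ∈ s, shiftedGeom (T i)) = 0 := by
  intro n
  induction n with
  | zero =>
    intro s hs
    obtain ⟨i, rfl⟩ := Finset.card_eq_one.1 hs
    simp [weightedCoeff_apply, coeff_succ_shiftedGeom, hzero]
  | succ n ih =>
    intro s hs
    obtain ⟨i, t, hit, rfl, ht⟩ := Finset.card_eq_succ.1 hs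
    obtain ⟨j, u, hju, rfl, hu⟩ := Finset.card_eq_succ.1 ht
    have hij : i ≠ j := fun h => hit (by simp [h])
    have hiu : i ∉ u := fun h => hit (by simp [h])
    apply hreg i j hij
    · rw [← sub_eq_zero, ← sub_mul, ← weightedCoeff_C_mul]
      have h : PowerSeries.C (T i - T j) * ∏ l ∈ insert i (insert j u), shiftedGeom (T l)
          = ∏ l ∈ insert i u, shiftedGeom (T l) - ∏ l ∈ insert j u, shiftedGeom (T l) := by
        rw [Finset.prod_insert hit, Finset.prod_insert hju, Finset.prod_insert hiu]
        linear_combination (∏ l ∈ u, shiftedGeom (T l)) *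
          C_sub_mul_shiftedGeom_mul_shiftedGeom (T i) (T j)
      rw [h, map_sub, ih _ (by rw [Finset.card_insert_of_notMem hiu, hu]), ih _ ht, sub_zero]
    · rw [map_weightedCoeff_of_skew _ _ _ _ (hG i j hij), map_prod]
      congr 2
      simp only [map_shiftedGeom, hT]
      refine Finset.prod_equiv (Equiv.swap i j) (fun l => ?_) (fun l _ => rfl)
      rcases eq_or_ne l i with rfl | hli
      · simp
      rcases eq_or_ne l j with rfl | hlj
      · simp
      rw [Equiv.swap_apply_of_ne_of_ne hli hlj]

end DividedDifferences

section Augmentation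

variable {R K : Type*} [CommRing R] [CommRing K]

/-- Under a homomorphism sending all `T i` to `1`, the coefficients of `∏ i ∈ s, shiftedGeom (T i)`
become those of `(X / (1 - X)) ^ s.card`, which are binomial coefficients. -/
theorem map_coeff_prod_shiftedGeom {ι : Type*} (T : ι → R) (ε : R →+* K) (hT : ∀ i, ε (T i) = 1)
    {r : ℕ} (s : Finset ι) (hs : s.card = r + 1) (a : ℕ) :
    ε (PowerSeries.coeff (a + 1) (∏ i ∈ s, shiftedGeom (T i))) = (a.choose r : K) := by
  rw [← PowerSeries.coeff_map, map_prod]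
  simp only [map_shiftedGeom, hT, Finset.prod_const, hs]
  have h1 : shiftedGeom (1 : K) = PowerSeries.X * PowerSeries.mk 1 := by
    simp only [shiftedGeom, one_pow]; rfl
  rw [h1, mul_pow, PowerSeries.mk_one_pow_eq_mk_choose_add]
  rcases lt_or_ge a r with h | h
  · rw [PowerSeries.coeff_X_pow_mul', if_neg (by omega), Nat.choose_eq_zero_of_lt h, Nat.cast_zero]
  · obtain ⟨d, rfl⟩ := Nat.exists_eq_add_of_le h
    rw [show r + d + 1 = d + (r + 1) by ring, PowerSeries.coeff_X_pow_mul, PowerSeries.coeff_mk]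

end Augmentation

/-- Lagrange interpolation in the form needed for vector-valued coefficients: if the binomial
moments `∑ a ∈ A, (a choose r) G a` of order less than `k ≥ |A|` lie in a submodule, then so do
all the `G a`. -/
theorem mem_of_sum_choose_smul_mem {p : ℕ} [Fact p.Prime] {M : Type*} [AddCommGroup M]
    [Module (ZMod p) M] (Q : Submodule (ZMod p) M) {k : ℕ} (A : Finset (ZMod p)) (hA : A.card ≤ k)
    (G : ZMod p → M)
    (h : ∀ r < k, ∑ a ∈ A, (a.val.choose r : ZMod p) • G a ∈ Q) {a : ZMod p} (ha : a ∈ A) :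
    G a ∈ Q := by
  -- Multiplying by the factors `a - b` one at a time, using
  -- `(a - b) * choose a r = (r + 1) * choose a (r + 1) + (r - b) * choose a r`.
  have key : ∀ (B : Finset (ZMod p)) (r : ℕ), r + B.card < k →
      ∑ a ∈ A, ((∏ b ∈ B, (a - b)) * (a.val.choose r : ZMod p)) • G a ∈ Q := by
    intro B
    induction B using Finset.induction_on with
    | empty => intro r hr; simpa using h r (by simpa using hr)
    | insert b B hb ih =>
      intro r hr
      rw [Finset.card_insert_of_notMem hb] at hr
      have h1 := Q.smul_mem ((r : ZMod p) + 1) (ih (r + 1) (by omega))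
      have h2 := Q.smul_mem ((r : ZMod p) - b) (ih r (by omega))
      have h3 := Q.add_mem h1 h2
      rw [Finset.smul_sum, Finset.smul_sum, ← Finset.sum_add_distrib] at h3
      convert h3 using 2 with a _
      rw [smul_smul, smul_smul, ← add_smul, Finset.prod_insert hb]
      congr 1
      have e : ((a.val.choose (r + 1) : ℕ) : ZMod p) * (r + 1)
          = (a.val.choose r : ZMod p) * (a - r) := by
        rcases le_or_gt r a.val with hle | hlt
        · have := congrArg (Nat.cast (R := ZMod p)) (Nat.choose_succ_right_eq a.val r)
          push_cast [Nat.cast_sub hle] at this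
          rwa [ZMod.natCast_zmod_val] at this
        · simp [Nat.choose_eq_zero_of_lt hlt, Nat.choose_eq_zero_of_lt (Nat.lt_succ_of_lt hlt)]
      linear_combination -(∏ b ∈ B, (a - b)) * e
  have h0 := key (A.erase a) 0 (by
    rw [Finset.card_erase_of_mem ha]
    have := Finset.card_pos.2 ⟨a, ha⟩
    omega)
  rw [Finset.sum_eq_single_of_mem a ha fun c hc hca => by
    rw [Finset.prod_eq_zero (Finset.mem_erase.2 ⟨hca, hc⟩) (sub_self c), zero_mul, zero_smul]] at h0
  have hne : (∏ b ∈ A.erase a, (a - b)) * ((a.val.choose 0 : ℕ) : ZMod p) ≠ 0 := by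
    simp only [Nat.choose_zero_right, Nat.cast_one, mul_one]
    exact Finset.prod_ne_zero_iff.2 fun b hb => sub_ne_zero.2 (Finset.ne_of_mem_erase hb).symm
  exact (Q.smul_mem_iff hne).1 h0

/-- If all divided differences of orders `r < k` of the skew polynomial with exponents in `A`,
`|A| ≤ k`, vanish at points congruent to `1` modulo a nilpotent ideal, then the polynomial is
zero: modulo `ker ε` times the ideal of coefficients they say that the binomial moments of the
coefficients vanish, so Nakayama's lemma applies. -/
theorem eq_zero_of_weightedCoeff_eq_zero {p : ℕ} [Fact p.Prime] {R : Type*} [CommRing R]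
    [Algebra (ZMod p) R] {k : ℕ} (T : Fin k → R) (ε : R →ₐ[ZMod p] ZMod p) (hT : ∀ i, ε (T i) = 1)
    (hε : ∀ x, ε x = 0 → IsNilpotent x) (A : Finset (ZMod p)) (hA : A.card ≤ k) (G : ZMod p → R)
    (h : ∀ (r : ℕ) (s : Finset (Fin k)), s.card = r + 1 →
      weightedCoeff A ZMod.val G (∏ i ∈ s, shiftedGeom (T i)) = 0) {a : ZMod p} (ha : a ∈ A) :
    G a = 0 := by
  classical
  set I : Ideal R := RingHom.ker ε
  set J : Ideal R := Ideal.span (A.image G : Set R)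
  have hGJ : ∀ b ∈ A, G b ∈ J := fun b hb =>
    Ideal.subset_span (Finset.mem_coe.2 (Finset.mem_image_of_mem G hb))
  have hJ : J = ⊥ := by
    refine Submodule.eq_bot_of_le_smul_of_le_jacobson_bot I J ⟨_, rfl⟩ ?_ ?_
    · refine Ideal.span_le.2 fun x hx => ?_
      obtain ⟨b, hb, rfl⟩ := Finset.mem_image.1 (Finset.mem_coe.1 hx)
      refine mem_of_sum_choose_smul_mem ((I • J : Ideal R).restrictScalars (ZMod p)) A hA G
        (fun r hr => ?_) hb
      obtain ⟨s, -, hs⟩ := Finset.exists_subset_card_eq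
        (s := (Finset.univ : Finset (Fin k))) (n := r + 1) (by simpa using hr)
      have h0 := h r s hs
      rw [weightedCoeff_apply] at h0
      have e : ∑ a ∈ A, (a.val.choose r : ZMod p) • G a
          = -∑ a ∈ A, (PowerSeries.coeff (a.val + 1) (∏ i ∈ s, shiftedGeom (T i))
            - algebraMap (ZMod p) R (a.val.choose r)) • G a := by
        simp only [smul_eq_mul, mul_comm _ (G _), mul_sub, Finset.sum_sub_distrib, h0, zero_sub,
          neg_neg]
        exact Finset.sum_congr rfl fun a _ => by rw [Algebra.smul_def, mul_comm]
      rw [e]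
      refine neg_mem (Submodule.sum_mem _ fun c hc => ?_)
      refine Submodule.smul_mem_smul (N := J) ?_ (hGJ c hc)
      rw [RingHom.mem_ker, map_sub, AlgHom.commutes, sub_eq_zero]
      exact map_coeff_prod_shiftedGeom T (ε : R →+* ZMod p) hT s hs c.val
    · exact fun x hx => Ideal.radical_le_jacobson (mem_nilradical.2 (hε x hx))
  have := hGJ a ha
  rwa [hJ, Ideal.mem_bot] at this

/-! ### The group algebra of an elementary abelian group and skew functions on it -/

theorem natCast_ne_zero_of_lt {p k : ℕ} (hk : 0 < k) (hkp : k < p) : (k : ZMod p) ≠ 0 := by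
  rw [Ne, ZMod.natCast_eq_zero_iff]
  exact Nat.not_dvd_of_pos_of_lt hk hkp

section GroupAlgebra

/-- A group algebra of an elementary abelian `p`-group in characteristic `p` has nilpotent
augmentation ideal: `x ^ p` is the augmentation of `x`. -/
theorem AddMonoidAlgebra.isNilpotent_of_lift_one_eq_zero {p : ℕ} [Fact p.Prime] {ι : Type*}
    (x : AddMonoidAlgebra (ZMod p) (ι → ZMod p))
    (hx : AddMonoidAlgebra.lift (ZMod p) (ZMod p) (ι → ZMod p) 1 x = 0) : IsNilpotent x := by
  have : CharP (AddMonoidAlgebra (ZMod p) (ι → ZMod p)) p :=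
    charP_of_injective_algebraMap (algebraMap (ZMod p) _).injective p
  have h : frobenius (AddMonoidAlgebra (ZMod p) (ι → ZMod p)) p = (algebraMap (ZMod p) _).comp
      (AddMonoidAlgebra.lift (ZMod p) (ZMod p) (ι → ZMod p) 1 :
        AddMonoidAlgebra (ZMod p) (ι → ZMod p) →+* ZMod p) := by
    refine AddMonoidAlgebra.ringHom_ext (fun r => ?_) fun v => ?_
    · simp [frobenius_def, AddMonoidAlgebra.single_pow, AddMonoidAlgebra.lift_single]
    · have hv : p • v = 0 := by ext; simp
      simp [frobenius_def, AddMonoidAlgebra.single_pow, AddMonoidAlgebra.lift_single, hv]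
  refine ⟨p, ?_⟩
  have := congrArg (fun f => f x) h
  simpa [frobenius_def, hx] using this

/-- In the group algebra of `𝔽_p ^ ι`, the difference of two of the variables acts injectively on
the elements that are reversed in sign by the swap of these variables: an element `z` that it kills
has coefficients that are constant on the lines in the direction `e_i - e_j`, and such a line is
stable under the swap. -/
theorem AddMonoidAlgebra.eq_zero_of_swap_skew {p : ℕ} [Fact p.Prime] (hp2 : p ≠ 2) {ι : Type*}
    [DecidableEq ι] {i j : ι} (hij : i ≠ j) (z : AddMonoidAlgebra (ZMod p) (ι → ZMod p))
    (hz : AddMonoidAlgebra.single (Pi.single i (-1)) 1 * z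
      = AddMonoidAlgebra.single (Pi.single j (-1)) 1 * z)
    (hswap : ∀ v, z.coeff (v ∘ Equiv.swap i j) = -z.coeff v) : z = 0 := by
  have h1 : ∀ v, z.coeff (v + (Pi.single i 1 - Pi.single j 1)) = z.coeff v := by
    intro v
    have := congrArg (fun y => y.coeff (v - Pi.single j 1)) hz
    simp only [AddMonoidAlgebra.coeff_single_mul_apply, one_mul, Pi.single_neg] at this
    convert this using 2 <;> abel
  have h2 : ∀ (n : ℕ) (v), z.coeff (v + n • (Pi.single i 1 - Pi.single j 1)) = z.coeff v := by
    intro n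
    induction n with
    | zero => simp
    | succ n ih => intro v; rw [succ_nsmul, ← add_assoc, h1, ih]
  ext v
  have h3 := h2 (v j - v i).val v
  have h4 : v + (v j - v i).val • (Pi.single i 1 - Pi.single j 1) = v ∘ Equiv.swap i j := by
    ext l
    rw [Pi.add_apply, Pi.smul_apply, nsmul_eq_mul, ZMod.natCast_zmod_val]
    rcases eq_or_ne l i with rfl | hli
    · simp [hij]
    rcases eq_or_ne l j with rfl | hlj
    · simp [hli]
    simp [Equiv.swap_apply_of_ne_of_ne hli hlj, hli, hlj]
  rw [h4, hswap] at h3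
  by_contra h
  exact ZMod.ne_neg_self ((Fact.out : p.Prime).odd_of_ne_two hp2) h h3.symm

end GroupAlgebra

section UniquenessOfChains

variable {p : ℕ} [Fact p.Prime] {m : ℕ}

/-- The restriction of a function on `𝔽_p ^ (m + 1)` to the hyperplane `∑ i, v i = a`, extended to
be constant along the direction `(1, …, 1)`, which is transverse to that hyperplane when
`m + 1 < p`. It is encoded as an element of the group algebra of `𝔽_p ^ (m + 1)`. -/
noncomputable def sliceElement (φ : (Fin (m + 1) → ZMod p) → ZMod p) (a : ZMod p) :
    AddMonoidAlgebra (ZMod p) (Fin (m + 1) → ZMod p) :=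
  .ofCoeff (Finsupp.equivFunOnFinite.symm fun v =>
    φ fun i => v i + (a - ∑ l, v l) / ((m + 1 : ℕ) : ZMod p))

theorem coeff_sliceElement (φ : (Fin (m + 1) → ZMod p) → ZMod p) (a : ZMod p)
    (v : Fin (m + 1) → ZMod p) : (sliceElement φ a).coeff v
      = φ fun i => v i + (a - ∑ l, v l) / ((m + 1 : ℕ) : ZMod p) := rfl

/-- The ring automorphism of the group algebra that permutes the coordinates of `𝔽_p ^ ι`. -/
noncomputable def permuteCoords {ι : Type*} (e : Equiv.Perm ι) :
    AddMonoidAlgebra (ZMod p) (ι → ZMod p) ≃+* AddMonoidAlgebra (ZMod p) (ι → ZMod p) :=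
  AddMonoidAlgebra.mapDomainRingEquiv (ZMod p) (AddEquiv.arrowCongr e (AddEquiv.refl (ZMod p)))

theorem coeff_permuteCoords {ι : Type*} (e : Equiv.Perm ι)
    (x : AddMonoidAlgebra (ZMod p) (ι → ZMod p)) (v : ι → ZMod p) :
    (permuteCoords e x).coeff v = x.coeff (v ∘ e) := by
  rw [permuteCoords, AddMonoidAlgebra.coeff_mapDomainRingEquiv, Finsupp.equivMapDomain_apply]
  rfl

theorem permuteCoords_single {ι : Type*} [DecidableEq ι] (e : Equiv.Perm ι) (i : ι) (c : ZMod p) :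
    permuteCoords e (AddMonoidAlgebra.single (Pi.single i c) 1)
      = AddMonoidAlgebra.single (Pi.single (e i) c) (1 : ZMod p) := by
  rw [permuteCoords, AddMonoidAlgebra.mapDomainRingEquiv_single]
  congr 1
  ext l
  change (Pi.single i c : ι → ZMod p) (e.symm l) = (Pi.single (e i) c : ι → ZMod p) l
  simp only [Pi.single_apply, Equiv.symm_apply_eq]

theorem permuteCoords_swap_sliceElement (φ : (Fin (m + 1) → ZMod p) → ZMod p)
    (hskew : ∀ i j, i ≠ j → ∀ v, φ (v ∘ Equiv.swap i j) = -φ v) (i j : Fin (m + 1)) (hij : i ≠ j)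
    (a : ZMod p) : permuteCoords (Equiv.swap i j) (sliceElement φ a) = -sliceElement φ a := by
  ext v
  rw [coeff_permuteCoords, AddMonoidAlgebra.coeff_neg, Finsupp.neg_apply, coeff_sliceElement,
    coeff_sliceElement, ← hskew i j hij]
  have : ∑ l, (v ∘ Equiv.swap i j) l = ∑ l, v l := Equiv.sum_comp (Equiv.swap i j) v
  rw [this]
  rfl

/-- The cycle condition, written as the vanishing of a polynomial with coefficients
`sliceElement φ a` at the group element `-e₀`. -/
theorem sum_sliceElement_mul_single_pow_eq_zero (hmp : m + 1 < p) (A : Finset (ZMod p))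
    (φ : (Fin (m + 1) → ZMod p) → ZMod p)
    (hsupp : ∀ v, φ v ≠ 0 → ∑ i, v i ∈ A)
    (hcycle : ∀ w : Fin m → ZMod p, ∑ x, φ (Fin.cons x w) = 0) :
    ∑ a ∈ A, sliceElement φ a *
      AddMonoidAlgebra.single (Pi.single 0 (-1)) (1 : ZMod p) ^ a.val = 0 := by
  have hm : ((m + 1 : ℕ) : ZMod p) ≠ 0 := natCast_ne_zero_of_lt m.succ_pos hmp
  ext v
  -- The translate of `v` along `(1, …, 1)` that lies in the hyperplane of sum zero.
  set u : Fin (m + 1) → ZMod p := fun i => v i - (∑ l, v l) / ((m + 1 : ℕ) : ZMod p) with hu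
  have hsum : ∑ i, u i = 0 := by
    simp only [hu, Finset.sum_sub_distrib, Finset.sum_const, Finset.card_univ, Fintype.card_fin,
      nsmul_eq_mul]
    rw [mul_div_cancel₀ _ hm, sub_self]
  have hterm : ∀ a : ZMod p, (sliceElement φ a *
      AddMonoidAlgebra.single (Pi.single 0 (-1)) (1 : ZMod p) ^ a.val).coeff v
      = φ (Fin.cons (u 0 + a) (Fin.tail u)) := by
    intro a
    rw [AddMonoidAlgebra.single_pow, one_pow, AddMonoidAlgebra.coeff_mul_single_apply, mul_one,
      coeff_sliceElement]
    have h1 : v + -(a.val • (Pi.single 0 (-1) : Fin (m + 1) → ZMod p)) = v + Pi.single 0 a := by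
      rw [← Pi.single_smul, ← Pi.single_neg, nsmul_eq_mul, ZMod.natCast_zmod_val]
      simp
    rw [h1]
    congr 1
    have h2 : ∑ l, (v + Pi.single 0 a : Fin (m + 1) → ZMod p) l = ∑ l, v l + a := by
      simp [Finset.sum_add_distrib]
    rw [h2]
    ext i
    refine Fin.cases ?_ (fun j => ?_) i
    · simp [hu]; ring
    · simp [hu, Fin.tail]; ring
  rw [AddMonoidAlgebra.coeff_sum, Finsupp.finsetSum_apply, Finset.sum_congr rfl fun a _ => hterm a,
    AddMonoidAlgebra.coeff_zero, Finsupp.zero_apply, ← hcycle (Fin.tail u),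
    ← Equiv.sum_comp (Equiv.addLeft (u 0))]
  refine Finset.sum_subset (Finset.subset_univ A) fun a _ ha => ?_
  by_contra hne
  refine ha ?_
  have h3 := hsupp _ hne
  rw [Fin.sum_univ_succ] at hsum
  rw [Fin.sum_univ_succ] at h3
  simp only [Fin.cons_zero, Fin.cons_succ, Fin.tail] at h3
  rwa [add_right_comm, hsum, zero_add] at h3

/-- A skew-symmetric function on `𝔽_p ^ (m + 1)` that satisfies the cycle condition and is supported
on tuples with sum in a set of at most `m + 1` elements is zero. -/
theorem eq_zero_of_skew_of_sum_cons_eq_zero (hp2 : p ≠ 2) (hmp : m + 1 < p) (A : Finset (ZMod p))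
    (hA : A.card ≤ m + 1) (φ : (Fin (m + 1) → ZMod p) → ZMod p)
    (hskew : ∀ i j, i ≠ j → ∀ v, φ (v ∘ Equiv.swap i j) = -φ v)
    (hsupp : ∀ v, φ v ≠ 0 → ∑ i, v i ∈ A)
    (hcycle : ∀ w : Fin m → ZMod p, ∑ x, φ (Fin.cons x w) = 0) : φ = 0 := by
  set T : Fin (m + 1) → AddMonoidAlgebra (ZMod p) (Fin (m + 1) → ZMod p) :=
    fun i => AddMonoidAlgebra.single (Pi.single i (-1)) 1 with hTdef
  have hσT : ∀ (e : Equiv.Perm (Fin (m + 1))) l, permuteCoords e (T l) = T (e l) :=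
    fun e l => permuteCoords_single e l (-1)
  have hσG := permuteCoords_swap_sliceElement φ hskew
  have hzero0 := sum_sliceElement_mul_single_pow_eq_zero hmp A φ hsupp hcycle
  have hzero : ∀ i, ∑ a ∈ A, sliceElement φ a * T i ^ a.val = 0 := by
    intro i
    rcases eq_or_ne 0 i with rfl | h0
    · exact hzero0
    · have := congrArg (permuteCoords (Equiv.swap 0 i)) hzero0
      simp only [map_sum, map_mul, map_pow, hσG 0 i h0, map_zero, neg_mul, Finset.sum_neg_distrib,
        neg_eq_zero] at this
      rw [← this]
      exact Finset.sum_congr rfl fun a _ => by rw [hσT, Equiv.swap_apply_left]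
  let σ : Fin (m + 1) → Fin (m + 1) → AddMonoidAlgebra (ZMod p) (Fin (m + 1) → ZMod p) →+*
      AddMonoidAlgebra (ZMod p) (Fin (m + 1) → ZMod p) :=
    fun i j => (permuteCoords (Equiv.swap i j)).toRingHom
  have hdiff := weightedCoeff_prod_shiftedGeom_eq_zero A ZMod.val (sliceElement φ) T σ
    (fun i j l => hσT _ l)
    (fun i j hij a => hσG i j hij a)
    (fun i j hij z hz hswap => AddMonoidAlgebra.eq_zero_of_swap_skew hp2 hij z hz fun v => by
      rw [← coeff_permuteCoords]
      exact congrArg (fun y => y.coeff v) hswap)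
    hzero
  have hslice : ∀ a ∈ A, sliceElement φ a = 0 := fun a ha =>
    eq_zero_of_weightedCoeff_eq_zero T (AddMonoidAlgebra.lift (ZMod p) (ZMod p) _ 1)
      (fun i => by simp [hTdef, AddMonoidAlgebra.lift_single])
      AddMonoidAlgebra.isNilpotent_of_lift_one_eq_zero A hA (sliceElement φ) hdiff ha
  ext v
  by_contra hne
  have h := congrArg (fun y => y.coeff v) (hslice _ (hsupp v hne))
  simp only [coeff_sliceElement, sub_self, zero_div, add_zero] at h
  exact hne h

end UniquenessOfChains

/-! ### Coefficients and rank of the modules of simplicial chains -/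

section ChainCoefficients

/-- An enumeration of a finite set with `n` elements; it orients the corresponding simplex. -/
noncomputable def Finset.enumeration {V : Type*} {n : ℕ} (σ : Finset V) (hσ : σ.card = n) :
    Fin n → V :=
  fun i => (σ.equivFinOfCardEq hσ).symm i

theorem Finset.enumeration_injective {V : Type*} {n : ℕ} (σ : Finset V) (hσ : σ.card = n) :
    Function.Injective (σ.enumeration hσ) :=
  Subtype.val_injective.comp (Equiv.injective _)

variable {R : Type*} [CommRing R] {V : Type*} [DecidableEq V]

theorem exists_perm_eq_comp_of_image_eq {n : ℕ} {v w : Fin n → V} (hv : Function.Injective v)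
    (h : Finset.univ.image v = Finset.univ.image w) :
    ∃ π : Equiv.Perm (Fin n), v = w ∘ π := by
  have hmem : ∀ i, ∃ j, w j = v i := fun i => by
    have hi : v i ∈ Finset.univ.image w := h ▸ Finset.mem_image_of_mem v (Finset.mem_univ i)
    simpa using hi
  choose f hf using hmem
  have hinj : Function.Injective f := fun i j hij => hv (by rw [← hf, ← hf, hij])
  exact ⟨Equiv.ofBijective f (Finite.injective_iff_bijective.1 hinj), funext fun i => (hf i).symm⟩

theorem Finset.image_enumeration {n : ℕ} (σ : Finset V) (hσ : σ.card = n) :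
    Finset.univ.image (σ.enumeration hσ) = σ := by
  ext x
  simp only [Finset.mem_image, Finset.mem_univ, true_and]
  constructor
  · rintro ⟨i, rfl⟩
    exact Subtype.property _
  · exact fun hx => ⟨σ.equivFinOfCardEq hσ ⟨x, hx⟩, by simp [Finset.enumeration]⟩

variable {X : PreAbstractSimplicialComplex V} {n : ℕ}

theorem SimplicialChain.apply_comp_perm (φ : SimplicialChain R X n)
    (π : Equiv.Perm (Fin (n + 1))) (v : Fin (n + 1) → V) :
    φ.1 (v ∘ π) = ((Equiv.Perm.sign π : ℤ) : R) * φ.1 v :=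
  φ.2.1 π v

theorem SimplicialChain.apply_eq_zero_of_not_injective (φ : SimplicialChain R X n)
    {v : Fin (n + 1) → V} (hv : ¬ Function.Injective v) : φ.1 v = 0 :=
  φ.2.2.1 v hv

theorem SimplicialChain.image_mem_faces (φ : SimplicialChain R X n)
    {v : Fin (n + 1) → V} (hv : φ.1 v ≠ 0) : Finset.univ.image v ∈ X.faces :=
  φ.2.2.2 v hv

theorem SimplicialChain.apply_eq_zero_of_enumeration (φ : SimplicialChain R X n)
    (v : Fin (n + 1) → V)
    (h : ∀ hσ : (Finset.univ.image v).card = n + 1,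
      φ.1 ((Finset.univ.image v).enumeration hσ) = 0) : φ.1 v = 0 := by
  by_cases hv : Function.Injective v
  · have hσ : (Finset.univ.image v).card = n + 1 := by
      rw [Finset.card_image_of_injective _ hv, Finset.card_fin]
    obtain ⟨π, hπ⟩ := exists_perm_eq_comp_of_image_eq hv
      (Finset.image_enumeration _ hσ).symm
    rw [hπ, φ.apply_comp_perm, h hσ, mul_zero]
  · exact φ.apply_eq_zero_of_not_injective hv

/-- The coefficients of a chain at the `n`-simplices that satisfy `P`, each with the orientation
given by its chosen enumeration. -/
noncomputable def chainCoeffs (R : Type*) [CommRing R] (X : PreAbstractSimplicialComplex V) (n : ℕ)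
    (P : Finset V → Prop) :
    SimplicialChain R X n →ₗ[R] ({σ : Finset V // σ.card = n + 1 ∧ P σ} → R) where
  toFun φ σ := φ.1 (σ.1.enumeration σ.2.1)
  map_add' _ _ := rfl
  map_smul' _ _ := rfl

theorem chainCoeffs_faces_injective :
    Function.Injective (chainCoeffs R X n (· ∈ X.faces)) := by
  rw [injective_iff_map_eq_zero]
  intro φ h
  refine Subtype.ext (funext fun v => ?_)
  by_contra hne
  exact hne (φ.apply_eq_zero_of_enumeration v fun hσ =>
    congrFun h ⟨_, hσ, φ.image_mem_faces hne⟩)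

/-- The elementary chain of an oriented simplex `(s 0, …, s n)` of `X`: its value at
`(v 0, …, v n)` is the determinant of the incidence matrix of `v` and `s`. -/
def elementaryChain (R : Type*) [CommRing R] (X : PreAbstractSimplicialComplex V) {n : ℕ}
    (s : Fin (n + 1) → V) (hs : Finset.univ.image s ∈ X.faces) : SimplicialChain R X n :=
  ⟨fun v => (Matrix.of fun i j => if v i = s j then (1 : R) else 0).det, by
    refine ⟨fun π v => ?_, fun v hv => ?_, fun v hv => ?_⟩
    · exact Matrix.det_permute π (Matrix.of fun i j => if v i = s j then (1 : R) else 0)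
    · simp only [Function.Injective, not_forall] at hv
      obtain ⟨i, j, hij, hne⟩ := hv
      exact Matrix.det_zero_of_row_eq hne (by ext l; simp [hij])
    · have hsub : Finset.univ.image s ⊆ Finset.univ.image v := by
        intro x hx
        obtain ⟨j, -, rfl⟩ := Finset.mem_image.1 hx
        by_contra hj
        refine hv (Matrix.det_eq_zero_of_column_eq_zero j fun i => ?_)
        exact if_neg fun h : v i = s j => hj (h ▸ Finset.mem_image_of_mem v (Finset.mem_univ i))
      have hsub' : Finset.univ.image v ⊆ Finset.univ.image s := by
        intro x hx
        obtain ⟨i, -, rfl⟩ := Finset.mem_image.1 hx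
        by_contra hi
        refine hv (Matrix.det_eq_zero_of_row_eq_zero i fun j => ?_)
        exact if_neg fun h : v i = s j => hi (h ▸ Finset.mem_image_of_mem s (Finset.mem_univ j))
      rwa [hsub'.antisymm hsub]⟩

theorem elementaryChain_apply_self (s : Fin (n + 1) → V) (hs : Finset.univ.image s ∈ X.faces)
    (hinj : Function.Injective s) : (elementaryChain R X s hs).1 s = 1 := by
  change (Matrix.of fun i j => if s i = s j then (1 : R) else 0).det = 1
  rw [← Matrix.det_one (n := Fin (n + 1))]
  congr 1
  ext i j
  simp [Matrix.one_apply, hinj.eq_iff]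

theorem elementaryChain_apply_of_image_ne (s v : Fin (n + 1) → V)
    (hs : Finset.univ.image s ∈ X.faces) (hv : Function.Injective v)
    (h : Finset.univ.image v ≠ Finset.univ.image s) : (elementaryChain R X s hs).1 v = 0 := by
  have hsub : ¬ Finset.univ.image v ⊆ Finset.univ.image s := fun hsub =>
    h (Finset.eq_of_subset_of_card_le hsub (Finset.card_image_le.trans
      (Finset.card_image_of_injective _ hv).ge))
  obtain ⟨x, hx, hxs⟩ := Finset.not_subset.1 hsub
  obtain ⟨i, -, rfl⟩ := Finset.mem_image.1 hx
  refine Matrix.det_eq_zero_of_row_eq_zero i fun j => ?_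
  exact if_neg fun h : v i = s j => hxs (h ▸ Finset.mem_image_of_mem s (Finset.mem_univ j))

theorem chainCoeffs_faces_surjective [Fintype V] :
    Function.Surjective (chainCoeffs R X n (· ∈ X.faces)) := by
  classical
  intro c
  refine ⟨∑ σ, c σ • elementaryChain R X (σ.1.enumeration σ.2.1)
    (by rw [Finset.image_enumeration]; exact σ.2.2), ?_⟩
  rw [map_sum]
  ext τ
  rw [Finset.sum_apply, Finset.sum_eq_single_of_mem τ (Finset.mem_univ τ)]
  · rw [map_smul, Pi.smul_apply, smul_eq_mul]
    refine (congrArg (c τ * ·) (elementaryChain_apply_self (X := X) _ ?_ ?_)).trans (mul_one _)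
    · rw [Finset.image_enumeration]; exact τ.2.2
    · exact Finset.enumeration_injective _ _
  · intro σ _ hne
    rw [map_smul, Pi.smul_apply, smul_eq_mul]
    refine (congrArg (c σ * ·)
      (elementaryChain_apply_of_image_ne (X := X) _ _ ?_ ?_ ?_)).trans (mul_zero _)
    · rw [Finset.image_enumeration]; exact σ.2.2
    · exact Finset.enumeration_injective _ _
    · rw [Finset.image_enumeration, Finset.image_enumeration]
      exact fun h => hne (Subtype.ext h.symm)

/-- The rank of the module of `n`-chains is the number of `n`-simplices. -/
theorem finrank_simplicialChain [StrongRankCondition R] [Fintype V] :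
    Module.finrank R (SimplicialChain R X n)
      = Nat.card {σ : Finset V // σ.card = n + 1 ∧ σ ∈ X.faces} := by
  classical
  rw [(LinearEquiv.ofBijective _ ⟨chainCoeffs_faces_injective (R := R) (X := X) (n := n),
    chainCoeffs_faces_surjective⟩).finrank_eq, Module.finrank_fintype_fun_eq_card,
    Nat.card_eq_fintype_card]

/-- The inclusion of chain modules induced by the inclusion of a subcomplex. -/
def SimplicialChain.inclusion {Y : PreAbstractSimplicialComplex V} (h : X.faces ⊆ Y.faces) :
    SimplicialChain R X n →ₗ[R] SimplicialChain R Y n where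
  toFun φ := ⟨φ.1, φ.2.1, φ.2.2.1, fun v hv => h (φ.2.2.2 v hv)⟩
  map_add' _ _ := rfl
  map_smul' _ _ := rfl

variable [Fintype V]

theorem simplicialBoundary_apply (φ : SimplicialChain R X (n + 1)) (v : Fin (n + 1) → V) :
    (simplicialBoundary R X n φ).1 v = ∑ x, φ.1 (Fin.cons x v) := rfl

theorem sum_simplicialBoundary_cons_eq_zero [IsDomain R] (h2 : (2 : R) ≠ 0)
    (φ : SimplicialChain R X (n + 1)) (w : Fin n → V) :
    ∑ x, (simplicialBoundary R X n φ).1 (Fin.cons x w) = 0 := by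
  simp only [simplicialBoundary_apply]
  have hswap : ∀ x y : V, φ.1 (Fin.cons x (Fin.cons y w : Fin (n + 1) → V))
      = -φ.1 (Fin.cons y (Fin.cons x w : Fin (n + 1) → V)) := by
    intro x y
    have e : (Fin.cons x (Fin.cons y w : Fin (n + 1) → V) : Fin (n + 1 + 1) → V)
        = (Fin.cons y (Fin.cons x w : Fin (n + 1) → V) : Fin (n + 1 + 1) → V)
          ∘ Equiv.swap 0 1 := by
      funext i
      refine Fin.cases ?_ (fun j => Fin.cases ?_ (fun l => ?_) j) i
      · rw [Function.comp_apply, Equiv.swap_apply_left]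
        rfl
      · simp
      · have h0 : (l.succ.succ : Fin (n + 1 + 1)) ≠ 0 := Fin.succ_ne_zero _
        have h1 : (l.succ.succ : Fin (n + 1 + 1)) ≠ 1 := by
          rw [← Fin.succ_zero_eq_one]
          exact fun h => Fin.succ_ne_zero _ (Fin.succ_injective _ h)
        simp [Equiv.swap_apply_of_ne_of_ne h0 h1]
    rw [e, φ.apply_comp_perm, Equiv.Perm.sign_swap (by simp)]
    simp
  have h : ∑ x, ∑ y, φ.1 (Fin.cons y (Fin.cons x w : Fin (n + 1) → V))
      = -∑ x, ∑ y, φ.1 (Fin.cons y (Fin.cons x w : Fin (n + 1) → V)) := by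
    conv_lhs => rw [Finset.sum_comm]
    simp only [← Finset.sum_neg_distrib]
    exact Finset.sum_congr rfl fun x _ => Finset.sum_congr rfl fun y _ => hswap _ _
  refine (mul_eq_zero.1 ?_).resolve_left h2
  linear_combination h

/-- A cycle (in the augmented sense, so that the condition is also meaningful for `n = 0`) is
determined by its coefficients at the simplices avoiding a given vertex `o`: the condition
at `w` expresses the coefficient of `[o, w]` through these. -/
theorem eq_zero_of_chainCoeffs_eq_zero (o : V) (ψ : SimplicialChain R X n)
    (hψ : ∀ w : Fin n → V, ∑ x, ψ.1 (Fin.cons x w) = 0)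
    (h : chainCoeffs R X n (o ∉ ·) ψ = 0) : ψ = 0 := by
  have havoid : ∀ v : Fin (n + 1) → V, (∀ i, v i ≠ o) → ψ.1 v = 0 := fun v hv =>
    ψ.apply_eq_zero_of_enumeration v fun hσ => congrFun h ⟨_, hσ, by simpa using hv⟩
  have hcons : ∀ w : Fin n → V, ψ.1 (Fin.cons o w) = 0 := by
    intro w
    by_cases hw : ∃ i, w i = o
    · refine ψ.apply_eq_zero_of_not_injective fun hinj => ?_
      obtain ⟨i, hi⟩ := hw
      exact (Fin.cons_injective_iff.1 hinj).1 ⟨i, hi⟩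
    · rw [← hψ w, Finset.sum_eq_single_of_mem o (Finset.mem_univ o)]
      intro x _ hx
      refine havoid _ fun i => ?_
      refine Fin.cases ?_ (fun j => ?_) i
      · simpa using hx
      · simpa using fun hj => hw ⟨j, hj⟩
  refine Subtype.ext (funext fun v => ?_)
  by_cases hv : ∃ i, v i = o
  · obtain ⟨i, hi⟩ := hv
    have e : v = (v ∘ Equiv.swap 0 i) ∘ Equiv.swap 0 i := by
      ext l; simp
    have e' : v ∘ Equiv.swap 0 i = Fin.cons o (Fin.tail (v ∘ Equiv.swap 0 i)) := by
      conv_lhs => rw [← Fin.cons_self_tail (v ∘ Equiv.swap 0 i)]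
      simp [hi]
    rw [e, ψ.apply_comp_perm, e', hcons, mul_zero]
    rfl
  · exact havoid v (not_exists.1 hv)

/-- Combining the boundary map with restriction to the simplices avoiding `o` does not change its
kernel, but puts it into a space whose dimension is that of the space of cycles of a full
skeleton. -/
theorem ker_chainCoeffs_comp_simplicialBoundary [IsDomain R] (h2 : (2 : R) ≠ 0) (o : V) :
    LinearMap.ker (chainCoeffs R X n (o ∉ ·) ∘ₗ simplicialBoundary R X n)
      = LinearMap.ker (simplicialBoundary R X n) := by
  refine le_antisymm (fun φ hφ => ?_) (LinearMap.ker_le_ker_comp _ _)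
  exact eq_zero_of_chainCoeffs_eq_zero o _ (sum_simplicialBoundary_cons_eq_zero h2 φ) hφ

end ChainCoefficients

/-! ### Counting faces and the homology of the sum complex -/

section SumComplex

variable {p : ℕ} [Fact p.Prime]

/-- Translation permutes the `k`-element subsets of `𝔽_p` and, since `k` is invertible, their
possible sums transitively. Hence each sum is taken by the same number of subsets. -/
theorem card_filter_sum_eq (k : ℕ) (hk : (k : ZMod p) ≠ 0) (a b : ZMod p) :
    (((Finset.univ : Finset (ZMod p)).powersetCard k).filter (∑ x ∈ ·, x = a)).card
      ≤ (((Finset.univ : Finset (ZMod p)).powersetCard k).filter (∑ x ∈ ·, x = b)).card := by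
  refine Finset.card_le_card_of_injOn
    (fun σ => σ.map (Equiv.addRight ((b - a) / k)).toEmbedding) ?_
    (Finset.map_injective _).injOn
  intro σ hσ
  obtain ⟨hσ, hsum⟩ := Finset.mem_filter.1 (Finset.mem_coe.1 hσ)
  have hcard := (Finset.mem_powersetCard.1 hσ).2
  refine Finset.mem_coe.2 (Finset.mem_filter.2 ⟨Finset.mem_powersetCard.2
    ⟨Finset.subset_univ _, by rw [Finset.card_map, hcard]⟩, ?_⟩)
  simp only [Finset.sum_map, Equiv.coe_toEmbedding, Equiv.coe_addRight]
  rw [Finset.sum_add_distrib, hsum, Finset.sum_const, hcard, nsmul_eq_mul, mul_div_cancel₀ _ hk,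
    add_sub_cancel]

/-- Double counting of the `k`-element subsets of `𝔽_p` by their sums. -/
theorem mul_card_filter_sum_eq {k : ℕ} (hk : 0 < k) (hkp : k < p) (a : ZMod p) :
    k * (((Finset.univ : Finset (ZMod p)).powersetCard k).filter (∑ x ∈ ·, x = a)).card
      = (p - 1).choose (k - 1) := by
  have hk0 := natCast_ne_zero_of_lt hk hkp
  have hp : 0 < p := hk.trans hkp
  set N := (((Finset.univ : Finset (ZMod p)).powersetCard k).filter (∑ x ∈ ·, x = a)).card
  have htotal : p.choose k = p * N := by
    have h := Finset.card_eq_sum_card_fiberwise (f := fun σ : Finset (ZMod p) => ∑ x ∈ σ, x)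
      (s := (Finset.univ : Finset (ZMod p)).powersetCard k) (t := Finset.univ)
      (fun _ _ => Finset.mem_coe.2 (Finset.mem_univ _))
    rw [Finset.card_powersetCard, Finset.card_univ, ZMod.card] at h
    rw [h, Finset.sum_congr rfl fun b _ =>
      (card_filter_sum_eq k hk0 b a).antisymm (card_filter_sum_eq k hk0 a b), Finset.sum_const,
      Finset.card_univ, ZMod.card, smul_eq_mul]
  have h := Nat.add_one_mul_choose_eq (p - 1) (k - 1)
  rw [Nat.sub_add_cancel hp, Nat.sub_add_cancel hk, htotal, mul_assoc] at h
  rw [mul_comm, ← Nat.eq_of_mul_eq_mul_left hp h]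

theorem mem_sumComplex_faces_of_card_eq {A : Finset (ZMod p)} {k : ℕ} (hk : 0 < k)
    {σ : Finset (ZMod p)} (hσ : σ.card = k) :
    σ ∈ (sumComplex A k).faces ↔ ∑ x ∈ σ, x ∈ A := by
  change σ.Nonempty ∧ (σ.card < k ∨ (σ.card = k ∧ ∑ x ∈ σ, x ∈ A)) ↔ _
  have hne : σ.Nonempty := Finset.card_pos.1 (hσ ▸ hk)
  simp [hne, hσ]

/-- The number of top-dimensional faces of the sum complex. -/
theorem mul_card_top_faces_sumComplex (A : Finset (ZMod p)) {n : ℕ} (hp : n + 1 < p) :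
    (n + 1) * Nat.card {σ : Finset (ZMod p) // σ.card = n + 1 ∧ σ ∈ (sumComplex A (n + 1)).faces}
      = A.card * (p - 1).choose n := by
  classical
  have h1 : Nat.card {σ : Finset (ZMod p) // σ.card = n + 1 ∧ σ ∈ (sumComplex A (n + 1)).faces}
      = (((Finset.univ : Finset (ZMod p)).powersetCard (n + 1)).filter
          (∑ x ∈ ·, x ∈ A)).card := by
    rw [Nat.card_eq_fintype_card, Fintype.card_subtype]
    congr 1
    ext σ
    simp only [Finset.mem_filter, Finset.mem_univ, true_and, Finset.mem_powersetCard,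
      Finset.subset_univ]
    exact and_congr_right fun h => mem_sumComplex_faces_of_card_eq n.succ_pos h
  rw [h1, Finset.card_eq_sum_card_fiberwise (f := fun σ : Finset (ZMod p) => ∑ x ∈ σ, x) (t := A)
    (fun σ hσ => Finset.mem_coe.2 (Finset.mem_filter.1 (Finset.mem_coe.1 hσ)).2), Finset.mul_sum,
    Finset.sum_congr rfl fun a ha => ?_, Finset.sum_const, smul_eq_mul]
  refine Eq.trans ?_ (mul_card_filter_sum_eq n.succ_pos hp a)
  rw [Finset.filter_filter]
  congr 2
  refine Finset.filter_congr fun σ _ => ?_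
  exact ⟨And.right, fun h => ⟨show ∑ x ∈ σ, x ∈ A by rwa [h], h⟩⟩

theorem natCard_subsets_avoiding (o : ZMod p) (n : ℕ) :
    Nat.card {σ : Finset (ZMod p) // σ.card = n + 1 ∧ o ∉ σ} = (p - 1).choose (n + 1) := by
  classical
  rw [Nat.card_eq_fintype_card, Fintype.card_subtype]
  have h : (Finset.univ.filter fun σ : Finset (ZMod p) => σ.card = n + 1 ∧ o ∉ σ)
      = (Finset.univ.erase o).powersetCard (n + 1) := by
    ext σ
    simp [Finset.mem_powersetCard, Finset.subset_erase, and_comm]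
  rw [h, Finset.card_powersetCard, Finset.card_erase_of_mem (Finset.mem_univ o), Finset.card_univ,
    ZMod.card]

/-- There are no chains above the top dimension. -/
theorem simplicialBoundaries_sumComplex_eq_bot (A : Finset (ZMod p)) (n : ℕ) :
    simplicialBoundaries (ZMod p) (sumComplex A (n + 1)) n = ⊥ := by
  have h0 : ∀ φ : SimplicialChain (ZMod p) (sumComplex A (n + 1)) (n + 1), φ = 0 := by
    intro φ
    refine Subtype.ext (funext fun v => ?_)
    by_contra hne
    have hinj : Function.Injective v := by
      by_contra hinj
      exact hne (φ.apply_eq_zero_of_not_injective hinj)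
    have hcard : (Finset.univ.image v).card = n + 1 + 1 := by
      rw [Finset.card_image_of_injective _ hinj, Finset.card_fin]
    obtain ⟨-, h | ⟨h, -⟩⟩ := φ.image_mem_faces hne <;> omega
  rw [simplicialBoundaries, LinearMap.range_eq_bot]
  exact LinearMap.ext fun φ => by rw [h0 φ, map_zero, map_zero]

/-- If `|A| ≤ k`, the top-dimensional boundary map of the sum complex is injective. -/
theorem ker_simplicialBoundary_sumComplex_eq_bot (A : Finset (ZMod p)) {n : ℕ} (hp : n + 2 < p)
    (hA : A.card ≤ n + 2) :
    LinearMap.ker (simplicialBoundary (ZMod p) (sumComplex A (n + 2)) n) = ⊥ := by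
  refine LinearMap.ker_eq_bot'.2 fun φ hφ => Subtype.ext ?_
  refine eq_zero_of_skew_of_sum_cons_eq_zero (by omega) hp A hA φ.1 (fun i j hij v => ?_)
    (fun v hv => ?_) (fun w => ?_)
  · rw [φ.apply_comp_perm, Equiv.Perm.sign_swap hij]
    simp
  · have hinj : Function.Injective v := by
      by_contra hinj
      exact hv (φ.apply_eq_zero_of_not_injective hinj)
    have h := (mem_sumComplex_faces_of_card_eq (k := n + 2) (by omega)
      (by rw [Finset.card_image_of_injective _ hinj, Finset.card_fin])).1 (φ.image_mem_faces hv)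
    rwa [Finset.sum_image hinj.injOn] at h
  · rw [← simplicialBoundary_apply, hφ]
    rfl

instance SimplicialChain.instModuleFinite {V : Type*} [DecidableEq V] [Fintype V]
    (F : Type*) [Field F] (X : PreAbstractSimplicialComplex V) (n : ℕ) :
    Module.Finite F (SimplicialChain F X n) :=
  inferInstanceAs (Module.Finite F (simplicialChains F X n))

/-- If `|A| ≥ k`, the top-dimensional boundary map of the sum complex has the largest rank that
is possible, as this holds by injectivity and a dimension count for `k`-element subsets of `A`. -/
theorem chainCoeffs_comp_simplicialBoundary_surjective (A : Finset (ZMod p)) {n : ℕ}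
    (hp : n + 2 < p) (hA : n + 2 ≤ A.card) :
    Function.Surjective (chainCoeffs (ZMod p) (sumComplex A (n + 2)) n ((0 : ZMod p) ∉ ·) ∘ₗ
      simplicialBoundary (ZMod p) (sumComplex A (n + 2)) n) := by
  classical
  obtain ⟨B, hBA, hB⟩ := Finset.exists_subset_card_eq hA
  have h2 : (2 : ZMod p) ≠ 0 := by
    exact_mod_cast natCast_ne_zero_of_lt (k := 2) (p := p) (by omega) (by omega)
  set D := chainCoeffs (ZMod p) (sumComplex B (n + 2)) n ((0 : ZMod p) ∉ ·) ∘ₗ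
      simplicialBoundary (ZMod p) (sumComplex B (n + 2)) n with hD
  have hinj : Function.Injective D := by
    rw [← LinearMap.ker_eq_bot, hD, ker_chainCoeffs_comp_simplicialBoundary h2,
      ker_simplicialBoundary_sumComplex_eq_bot B hp hB.le]
  have hdim : Module.finrank (ZMod p) (SimplicialChain (ZMod p) (sumComplex B (n + 2)) (n + 1))
      = Module.finrank (ZMod p)
        ({σ : Finset (ZMod p) // σ.card = n + 1 ∧ (0 : ZMod p) ∉ σ} → ZMod p) := by
    rw [finrank_simplicialChain, Module.finrank_fintype_fun_eq_card, ← Nat.card_eq_fintype_card,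
      natCard_subsets_avoiding]
    have h := mul_card_top_faces_sumComplex B (n := n + 1) hp
    rw [hB] at h
    exact Nat.eq_of_mul_eq_mul_left (by omega) h
  have hsurj : Function.Surjective D :=
    (LinearMap.injective_iff_surjective_of_finrank_eq_finrank hdim).1 hinj
  have hfaces : (sumComplex B (n + 2)).faces ⊆ (sumComplex A (n + 2)).faces :=
    fun σ hσ => ⟨hσ.1, hσ.2.imp_right fun h => ⟨h.1, hBA h.2⟩⟩
  intro c
  obtain ⟨φ, rfl⟩ := hsurj c
  exact ⟨SimplicialChain.inclusion hfaces φ, rfl⟩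

/-- Rank-nullity for the top-dimensional boundary map of the sum complex. -/
theorem finrank_ker_simplicialBoundary_sumComplex (A : Finset (ZMod p)) {n : ℕ}
    (hp : n + 2 < p) (hA : n + 2 ≤ A.card) :
    (Module.finrank (ZMod p)
        (LinearMap.ker (simplicialBoundary (ZMod p) (sumComplex A (n + 2)) n)) : ℚ)
      = ((A.card : ℚ) / ((n + 2 : ℕ) : ℚ) - 1) * ((p - 1).choose (n + 1) : ℚ) := by
  classical
  have h2 : (2 : ZMod p) ≠ 0 := by
    exact_mod_cast natCast_ne_zero_of_lt (k := 2) (p := p) (by omega) (by omega)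
  have h := LinearMap.finrank_range_add_finrank_ker
    (chainCoeffs (ZMod p) (sumComplex A (n + 2)) n ((0 : ZMod p) ∉ ·) ∘ₗ
      simplicialBoundary (ZMod p) (sumComplex A (n + 2)) n)
  rw [ker_chainCoeffs_comp_simplicialBoundary h2, LinearMap.range_eq_top.2
    (chainCoeffs_comp_simplicialBoundary_surjective A hp hA), finrank_top,
    Module.finrank_fintype_fun_eq_card, ← Nat.card_eq_fintype_card, natCard_subsets_avoiding,
    finrank_simplicialChain] at h
  have hcount := mul_card_top_faces_sumComplex A (n := n + 1) hp
  rw [← h] at hcount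
  have hq := congrArg (Nat.cast (R := ℚ)) hcount
  push_cast at hq ⊢
  field_simp
  linear_combination hq

end SumComplex

theorem theorem1p2 (p : ℕ) [Fact p.Prime] (k : ℕ) (hk : 1 < k) (hkp : k < p)
    (A : Finset (ZMod p)) :
    Module.Finite (ZMod p) (SimplicialHomology (ZMod p) (sumComplex A k) (k - 1)) ∧
    (Module.finrank (ZMod p) (SimplicialHomology (ZMod p) (sumComplex A k) (k - 1)) : ℚ) =
      if A.card ≤ k then 0
      else ((A.card : ℚ) / (k : ℚ) - 1) * ((p - 1).choose (k - 1) : ℚ) := by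
  obtain ⟨n, rfl⟩ := Nat.exists_eq_add_of_le' hk
  change Module.Finite (ZMod p) (SimplicialHomology (ZMod p) (sumComplex A (n + 2)) (n + 1)) ∧
    (Module.finrank (ZMod p) (SimplicialHomology (ZMod p) (sumComplex A (n + 2)) (n + 1)) : ℚ) =
      if A.card ≤ n + 2 then 0
      else ((A.card : ℚ) / ((n + 2 : ℕ) : ℚ) - 1) * ((p - 1).choose (n + 1) : ℚ)
  refine ⟨inferInstance, ?_⟩
  have hB : (simplicialBoundaries (ZMod p) (sumComplex A (n + 2)) (n + 1)).submoduleOf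
      (simplicialCycles (ZMod p) (sumComplex A (n + 2)) (n + 1)) = ⊥ := by
    rw [simplicialBoundaries_sumComplex_eq_bot A (n + 1), Submodule.submoduleOf,
      Submodule.comap_bot, Submodule.ker_subtype]
  rw [(Submodule.quotEquivOfEqBot _ hB).finrank_eq]
  change (Module.finrank (ZMod p)
    (LinearMap.ker (simplicialBoundary (ZMod p) (sumComplex A (n + 2)) n)) : ℚ) = _
  split_ifs with hA
  · rw [ker_simplicialBoundary_sumComplex_eq_bot A hkp hA, finrank_bot, Nat.cast_zero]
  · exact finrank_ker_simplicialBoundary_sumComplex A hkp (by omega)
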